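/- Let $G$ be an essential finite reflection group acting on $V=\mathbb R^n$: a finite group of orthogonal transformations generated by reflections that fixes no nonzero vector. For a reflection group $W$ on $V$, let $d_1(W)\le\dots\le d_n(W)$ be the degrees of a set of basic invariants of $W$, that is, of algebraically independent homogeneous generators $\pi_1,\dots,\pi_n$ of $\mathbb R[V]^W$, labelled by weakly increasing degree; a point is called $W$-general if it lies on no reflection hyperplane of $W$. Let $\mathcal H_i$ be the set of points of $V$ that lie in an $i$-dimensional intersection of reflection hyperplanes of $G$ (so $\mathcal H_n=V$, the empty intersection). For an integer $d\ge 0$ let $\ell(d)$ be the smallest $\ell\ge 0$ such that for every $p\in V\setminus\mathcal H_{\ell}$ there is a reflection subgroup $G'\subseteq G$ such that $p$ is $G'$-general and $2d_n(G')>d$. For $1\le k\le n$ put $\ell'(k)=\ell(2d_k(G))$. For $f\in\mathbb R[V]^G$ write $V_{\mathbb R}(f)=\{x\in V: f(x)=0\}$, and call $f$ $G$-finite if $V_{\mathbb R}(f)=\emptyset$ or there is $p\in V_{\mathbb R}(f)$ such that the restriction of $f$ to the sphere $\{q\in V:\|q\|=\|p\|\}$ has only finitely many extreme points (points at which the restriction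 attains its maximum or its minimum). **Theorem.** Let $f\in\mathbb R[V]^G$ be $G$-finite and $X=V_{\mathbb R}(f)$. 1. If $f\in\mathbb R[\pi_1,\dots,\pi_k]$ for some set of basic invariants $\pi_1,\dots,\pi_n$ of $G$ and some $1\le k\le n$, then $X\ne\emptyset$ if and only if $X\cap\mathcal H_{\ell'(k)}\neq\emptyset$. 2. Let $d=\deg f$ (with $\deg 0=0$). If $d\notin\{2,3\}$, then $X\neq\emptyset$ if and only if $X\cap\mathcal H_{\ell(d)}\neq\emptyset$. If $d\in\{2,3\}$, then $X\neq\emptyset$ if and only if $X\cap\mathcal H_{1}\neq\emptyset$. -/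

import Mathlib

namespace ReflectionVariety

/-- The Euclidean space `V = ℝⁿ`. -/
abbrev V (n : ℕ) : Type := EuclideanSpace ℝ (Fin n)

/-- The value of a polynomial `f ∈ ℝ[V]` at a point of `V`. -/
noncomputable def value {n : ℕ} (f : MvPolynomial (Fin n) ℝ) (x : V n) : ℝ :=
  MvPolynomial.eval x.ofLp f

/-- The linear hyperplane orthogonal to `v` (a hyperplane when `v ≠ 0`). -/
noncomputable def hyperplane {n : ℕ} (v : V n) : Submodule ℝ (V n) := (Submodule.span ℝ {v})ᗮ

/-- A (linear, orthogonal) reflection: it fixes the hyperplane orthogonal to some nonzero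
vector `v` and sends `v` to `-v`. -/
def IsReflection {n : ℕ} (g : V n ≃ₗᵢ[ℝ] V n) : Prop :=
  ∃ v : V n, v ≠ 0 ∧ g = (hyperplane v).reflection

/-- A finite reflection group: a finite group of orthogonal transformations that is generated
by the reflections it contains. -/
structure IsReflectionGroup {n : ℕ} (G : Subgroup (V n ≃ₗᵢ[ℝ] V n)) : Prop where
  finite : Finite G
  generated : Subgroup.closure {g | g ∈ G ∧ IsReflection g} = G

/-- `G` is essential if no nonzero vector is fixed by all of `G`. -/
def IsEssential {n : ℕ} (G : Subgroup (V n ≃ₗᵢ[ℝ] V n)) : Prop :=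
  ∀ x : V n, (∀ g ∈ G, g x = x) → x = 0

/-- The reflection arrangement of `G`: the set of all reflection hyperplanes of `G`. -/
def arrangement {n : ℕ} (G : Subgroup (V n ≃ₗᵢ[ℝ] V n)) : Set (Submodule ℝ (V n)) :=
  {H | ∃ v : V n, v ≠ 0 ∧ (hyperplane v).reflection ∈ G ∧ H = hyperplane v}

/-- The flats of the reflection arrangement: the intersections of families of reflection
hyperplanes. The empty family gives `V` itself. -/
def IsFlat {n : ℕ} (G : Subgroup (V n ≃ₗᵢ[ℝ] V n)) (F : Submodule ℝ (V n)) : Prop :=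
  ∃ S : Set (Submodule ℝ (V n)), S ⊆ arrangement G ∧ F = sInf S

/-- The closed stratum: the points contained in a flat of dimension `i`. -/
def stratum {n : ℕ} (G : Subgroup (V n ≃ₗᵢ[ℝ] V n)) (i : ℕ) : Set (V n) :=
  {p | ∃ F : Submodule ℝ (V n), IsFlat G F ∧ Module.finrank ℝ F = i ∧ p ∈ F}

/-- A point is `G`-general if it lies on no reflection hyperplane of `G`. -/
def IsGeneral {n : ℕ} (G : Subgroup (V n ≃ₗᵢ[ℝ] V n)) (p : V n) : Prop :=
  ∀ H ∈ arrangement G, p ∉ H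

/-- The ring `ℝ[V]^G` of `G`-invariant polynomials. Over `ℝ` a polynomial is determined by its
values, so invariance is expressed through values. -/
noncomputable def invariants {n : ℕ} (G : Subgroup (V n ≃ₗᵢ[ℝ] V n)) :
    Subalgebra ℝ (MvPolynomial (Fin n) ℝ) where
  carrier := {f | ∀ g ∈ G, ∀ x : V n, value f (g x) = value f x}
  mul_mem' := by
    intro a b ha hb g hg x
    have h1 := ha g hg x
    have h2 := hb g hg x
    simp only [value] at h1 h2
    simp only [value, map_mul, h1, h2]
  add_mem' := by
    intro a b ha hb g hg x
    have h1 := ha g hg x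
    have h2 := hb g hg x
    simp only [value] at h1 h2
    simp only [value, map_add, h1, h2]
  algebraMap_mem' := by
    intro r g _ x
    simp [value, MvPolynomial.algebraMap_eq]

/-- A set of basic invariants of `G`: homogeneous, algebraically independent generators of
`ℝ[V]^G`, labelled by weakly increasing degree. Their degrees are the degrees
`d₁(G) ≤ … ≤ dₙ(G)` of `G`. -/
structure IsBasicInvariants {n : ℕ} (G : Subgroup (V n ≃ₗᵢ[ℝ] V n))
    (π : Fin n → MvPolynomial (Fin n) ℝ) : Prop where
  homogeneous : ∀ i, (π i).IsHomogeneous (π i).totalDegree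
  algebraicIndependent : AlgebraicIndependent ℝ π
  generates : Algebra.adjoin ℝ (Set.range π) = invariants G
  ordered : Monotone fun i => (π i).totalDegree

/-- The assertion `d < 2 dₙ(G)`, where `dₙ(G)` is the largest degree of a basic invariant
of `G` (as a group acting on all of `V`). -/
def LtTwiceTopDegree {n : ℕ} (d : ℕ) (G : Subgroup (V n ≃ₗᵢ[ℝ] V n)) : Prop :=
  ∃ π : Fin n → MvPolynomial (Fin n) ℝ, IsBasicInvariants G π ∧
    ∃ i, (∀ j, (π j).totalDegree ≤ (π i).totalDegree) ∧ d < 2 * (π i).totalDegree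

/-- The number `ℓ(d)`: the smallest `ℓ` such that for every point `p` outside of the closed
stratum of dimension `ℓ` there is a reflection subgroup `G' ⊆ G` such that `p` is `G'`-general
and `2 dₙ(G') > d`. (`ℓ = n` always has this property, as the `n`-th stratum is `V`.) -/
noncomputable def strNum {n : ℕ} (G : Subgroup (V n ≃ₗᵢ[ℝ] V n)) (d : ℕ) : ℕ :=
  sInf {ℓ : ℕ | ∀ p : V n, p ∉ stratum G ℓ →
    ∃ G' : Subgroup (V n ≃ₗᵢ[ℝ] V n), G' ≤ G ∧ IsReflectionGroup G' ∧ IsGeneral G' p ∧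
      LtTwiceTopDegree d G'}

/-- The number `ℓ'(k) = ℓ(2 dₖ(G))`, with `dₖ(G)` read off from a set `π` of basic invariants
of `G`. The index `k : Fin n` counts from `0`. -/
noncomputable def secStrNum {n : ℕ} (G : Subgroup (V n ≃ₗᵢ[ℝ] V n))
    (π : Fin n → MvPolynomial (Fin n) ℝ) (k : Fin n) : ℕ :=
  strNum G (2 * (π k).totalDegree)

/-- The real variety of `f`. -/
def realVariety {n : ℕ} (f : MvPolynomial (Fin n) ℝ) : Set (V n) := {x | value f x = 0}

/-- `G`-finiteness of an invariant polynomial: there is no zero, or there is a zero `p` such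
that the restriction of `f` to the sphere around the origin through `p` has only finitely many
extreme points, that is, points at which it attains its maximum or its minimum. -/
def IsGFinite {n : ℕ} (f : MvPolynomial (Fin n) ℝ) : Prop :=
  realVariety f = ∅ ∨ ∃ p ∈ realVariety f,
    {q : V n | q ∈ Metric.sphere (0 : V n) ‖p‖ ∧
      IsExtrOn (value f) (Metric.sphere (0 : V n) ‖p‖) q}.Finite

end ReflectionVariety

open ReflectionVariety

open scoped RealInnerProductSpace Pointwise

/-! If `f` has a zero `p` and finitely many extreme points on the sphere through `p`, then its
minimum there is `≤ 0` and its maximum is `≥ 0`. Strata are cones, so as soon as these extreme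
points lie in a stratum, the intermediate value theorem along the segments to the origin gives a
zero in that stratum. What has to be located are therefore isolated extreme points on spheres.

Let `q` be general for a reflection subgroup `G'` with basic invariants `π`. By simple transitivity
on chambers `q` has trivial stabilizer in `G'`, and averaging produces invariants with arbitrary
differential at `q`; hence the `π j` are local coordinates at `q`. An invariant of degree less than
`2 deg (π i)` is affine in `π i`, one of degree less than `deg (π i)` does not involve it. So where
only `π i` varies, which for `deg (π i) > 2` happens inside a sphere, `f` is affine in `π i`; an
extremum at `q` makes it constant, and `q` is not isolated.

In degree at most three one subtracts a multiple of `‖x‖²` to make `q` a critical point. On a line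
in the direction of a root an invariant cubic is symmetric about the mirror, hence quadratic, and at
`q` its second derivative along a root not orthogonal to `q` vanishes. If the roots `α`, `β` are
independent and none of `α`, `β` and the mirror image of `α` in `β` is orthogonal to `q`, then the
cubic is constant on the plane `q + ℝ α + ℝ β`, which meets the sphere in infinitely many points.
-/

namespace ReflectionVariety

variable {n : ℕ} {G : Subgroup (V n ≃ₗᵢ[ℝ] V n)} {q : V n}

section Roots

/-- The orthogonal reflection in the hyperplane orthogonal to `v`; the identity if `v = 0`. -/
noncomputable def reflection (v : V n) : V n ≃ₗᵢ[ℝ] V n := (hyperplane v).reflection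

/-- A root of `G`: a normal vector, of any length, of a reflection hyperplane of `G`. -/
def IsRoot (G : Subgroup (V n ≃ₗᵢ[ℝ] V n)) (v : V n) : Prop := v ≠ 0 ∧ reflection v ∈ G

theorem mem_hyperplane {v x : V n} : x ∈ hyperplane v ↔ ⟪v, x⟫ = 0 :=
  Submodule.mem_orthogonal_singleton_iff_inner_right

theorem reflection_apply (v x : V n) : reflection v x = x - (2 * ⟪v, x⟫ / ‖v‖ ^ 2) • v := by
  unfold reflection hyperplane
  rw [Submodule.reflection_orthogonal_apply, Submodule.reflection_singleton_apply, neg_sub,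
    two_smul, ← add_smul]
  simp only [RCLike.ofReal_real_eq_id, id]
  congr 2
  ring

theorem reflection_self (v : V n) : reflection v v = -v :=
  Submodule.reflection_orthogonalComplement_singleton_eq_neg v

theorem reflection_mul_self (v : V n) : reflection v * reflection v = 1 :=
  Submodule.reflection_mul_reflection _

theorem reflection_inv (v : V n) : (reflection v)⁻¹ = reflection v := Submodule.reflection_inv

theorem reflection_apply_eq_self {v x : V n} (h : ⟪v, x⟫ = 0) : reflection v x = x :=
  Submodule.reflection_mem_subspace_eq_self (mem_hyperplane.2 h)

theorem reflection_smul {c : ℝ} (hc : c ≠ 0) (v : V n) : reflection (c • v) = reflection v := by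
  simp only [reflection, hyperplane, Submodule.span_singleton_smul_eq hc.isUnit]

theorem reflection_neg (v : V n) : reflection (-v) = reflection v := by
  rw [← neg_one_smul ℝ v, reflection_smul (neg_ne_zero.2 one_ne_zero)]

theorem reflection_map (g : V n ≃ₗᵢ[ℝ] V n) (v : V n) :
    reflection (g v) = g * reflection v * g⁻¹ := by
  ext1 x
  obtain ⟨y, rfl⟩ := g.surjective x
  have hy : g⁻¹ (g y) = y := g.symm_apply_apply y
  simp only [LinearIsometryEquiv.coe_mul, Function.comp_apply, hy, reflection_apply,
    g.inner_map_map, g.norm_map, map_sub, map_smul]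

theorem IsRoot.map {v : V n} (hv : IsRoot G v) {g : V n ≃ₗᵢ[ℝ] V n} (hg : g ∈ G) :
    IsRoot G (g v) :=
  ⟨g.map_eq_zero_iff.not.2 hv.1,
    reflection_map g v ▸ G.mul_mem (G.mul_mem hg hv.2) (G.inv_mem hg)⟩

theorem IsRoot.smul {v : V n} (hv : IsRoot G v) {c : ℝ} (hc : c ≠ 0) : IsRoot G (c • v) :=
  ⟨smul_ne_zero hc hv.1, (reflection_smul hc v).symm ▸ hv.2⟩

theorem IsRoot.neg {v : V n} (hv : IsRoot G v) : IsRoot G (-v) :=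
  ⟨neg_ne_zero.2 hv.1, (reflection_neg v).symm ▸ hv.2⟩

theorem IsGeneral.inner_ne_zero (hq : IsGeneral G q) {v : V n} (hv : IsRoot G v) : ⟪v, q⟫ ≠ 0 :=
  fun h => hq _ ⟨v, hv.1, hv.2, rfl⟩ (mem_hyperplane.2 h)

end Roots

section SimpleTransitivity

/-- The positive system of unit roots of `G` singled out by the functional `⟪·, q⟫`. -/
def posRoots (G : Subgroup (V n ≃ₗᵢ[ℝ] V n)) (q : V n) : Set (V n) :=
  {v | IsRoot G v ∧ ‖v‖ = 1 ∧ 0 < ⟪v, q⟫}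

/-- The simple roots of the positive system `posRoots G q`, characterized without linear algebra:
the positive unit roots `v` whose reflection makes no positive unit root but `v` negative. -/
def simpleRoots (G : Subgroup (V n ≃ₗᵢ[ℝ] V n)) (q : V n) : Set (V n) :=
  {v | v ∈ posRoots G q ∧ ∀ u ∈ posRoots G q, ⟪reflection v u, q⟫ < 0 → u = v}

theorem inner_reflection_of_norm_eq_one {v : V n} (hv : ‖v‖ = 1) (x y : V n) :
    ⟪reflection v x, y⟫ = ⟪x, y⟫ - 2 * ⟪v, x⟫ * ⟪v, y⟫ := by
  rw [reflection_apply, hv, inner_sub_left, real_inner_smul_left, one_pow, div_one]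

theorem injOn_reflection_posRoots : Set.InjOn reflection (posRoots G q) := by
  rintro u ⟨-, hu, huq⟩ v ⟨-, hv, hvq⟩ huv
  have h : ⟪u, q⟫ • u = ⟪v, q⟫ • v := by
    have := DFunLike.congr_fun huv q
    rw [reflection_apply, reflection_apply, hu, hv, sub_right_inj] at this
    simpa [mul_smul] using this
  have hnorm := congrArg norm h
  rw [norm_smul, norm_smul, hu, hv, Real.norm_of_nonneg huq.le, Real.norm_of_nonneg hvq.le, mul_one,
    mul_one] at hnorm
  rw [← hnorm] at h
  exact smul_right_injective _ huq.ne' h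

theorem finite_posRoots [Finite G] : (posRoots G q).Finite := by
  refine .of_finite_image ((Set.toFinite (G : Set (V n ≃ₗᵢ[ℝ] V n))).subset ?_)
    injOn_reflection_posRoots
  rintro _ ⟨v, hv, rfl⟩
  exact hv.1.2

theorem map_mem_posRoots (hq : IsGeneral G q) {g : V n ≃ₗᵢ[ℝ] V n} (hg : g ∈ G) {v : V n}
    (hv : v ∈ posRoots G q) (h : 0 ≤ ⟪g v, q⟫) : g v ∈ posRoots G q :=
  have hgv := hv.1.map hg
  ⟨hgv, by rw [g.norm_map, hv.2.1], h.lt_of_ne' (hq.inner_ne_zero hgv)⟩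

theorem neg_map_mem_posRoots (hq : IsGeneral G q) {g : V n ≃ₗᵢ[ℝ] V n} (hg : g ∈ G) {v : V n}
    (hv : v ∈ posRoots G q) (h : ⟪g v, q⟫ ≤ 0) : -g v ∈ posRoots G q := by
  have hgv := hv.1.map hg
  refine ⟨hgv.neg, by rw [norm_neg, g.norm_map, hv.2.1], ?_⟩
  rw [inner_neg_left, neg_pos]
  exact h.lt_of_ne (hq.inner_ne_zero hgv)

theorem exists_posRoots_reflection_eq (hq : IsGeneral G q) {v : V n} (hv : IsRoot G v) :
    ∃ u ∈ posRoots G q, reflection u = reflection v := by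
  wlog h : 0 < ⟪v, q⟫ generalizing v
  · have hneg : 0 < ⟪-v, q⟫ := by
      rw [inner_neg_left, neg_pos]
      exact (not_lt.1 h).lt_of_ne (hq.inner_ne_zero hv)
    rw [← reflection_neg v]
    exact this hv.neg hneg
  have hc : 0 < ‖v‖⁻¹ := inv_pos.2 (norm_pos_iff.2 hv.1)
  refine ⟨‖v‖⁻¹ • v, ⟨hv.smul hc.ne', norm_smul_inv_norm hv.1, ?_⟩, reflection_smul hc.ne' v⟩
  rw [real_inner_smul_left]
  exact mul_pos hc h

theorem exists_lower_of_notMem_simpleRoots (hq : IsGeneral G q) {v : V n} (hv : v ∈ posRoots G q)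
    (hns : v ∉ simpleRoots G q) :
    ∃ u ∈ posRoots G q, ⟪u, q⟫ < ⟪v, q⟫ ∧ 0 < ⟪u, v⟫ ∧ ⟪u, v⟫ < 1 := by
  obtain ⟨u, hu, hneg, hne⟩ : ∃ u ∈ posRoots G q, ⟪reflection v u, q⟫ < 0 ∧ u ≠ v := by
    by_contra! h
    exact hns ⟨hv, h⟩
  have hlt : ⟪u, v⟫ < 1 := (inner_lt_one_iff_real_of_norm_eq_one hu.2.1 hv.2.1).2 hne
  have hval := inner_reflection_of_norm_eq_one hv.2.1 u q
  rw [real_inner_comm u v] at hval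
  have huq := hu.2.2
  have hvq := hv.2.2
  have hpos : 0 < ⟪u, v⟫ := by
    by_contra h
    nlinarith
  rcases lt_or_ge ⟪u, q⟫ ⟪v, q⟫ with h | h
  · exact ⟨u, hu, h, hpos, hlt⟩
  · have hinner : ⟪-reflection v u, v⟫ = ⟪u, v⟫ := by
      rw [← LinearIsometryEquiv.inner_map_map (reflection v) u v, reflection_self, inner_neg_left,
        inner_neg_right]
    refine ⟨-reflection v u, neg_map_mem_posRoots hq hv.1.2 hu hneg.le, ?_, ?_, ?_⟩
    · rw [inner_neg_left, hval]
      nlinarith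
    · rwa [hinner]
    · rwa [hinner]

theorem reflection_mem_of_lower (hq : IsGeneral G q) {H : Subgroup (V n ≃ₗᵢ[ℝ] V n)} {u v : V n}
    (hu : u ∈ posRoots G q) (hv : v ∈ posRoots G q) (hlt : ⟪u, q⟫ < ⟪v, q⟫) (h0 : 0 < ⟪u, v⟫)
    (h1 : ⟪u, v⟫ < 1) (hH : ∀ w ∈ posRoots G q, ⟪w, q⟫ < ⟪v, q⟫ → reflection w ∈ H) :
    reflection v ∈ H := by
  have hval := inner_reflection_of_norm_eq_one hu.2.1 v q
  have huq := hu.2.2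
  have huH := hH u hu hlt
  have hw : reflection (reflection u v) ∈ H := by
    rcases le_total 0 ⟪reflection u v, q⟫ with h | h
    · exact hH _ (map_mem_posRoots hq hu.1.2 hv h) (by rw [hval]; nlinarith)
    · rw [← reflection_neg]
      exact hH _ (neg_map_mem_posRoots hq hu.1.2 hv h) (by rw [inner_neg_left, hval]; nlinarith)
  rw [reflection_map] at hw
  convert H.mul_mem (H.mul_mem (H.inv_mem huH) hw) huH using 1
  group

theorem reflection_mem_of_mem_posRoots [Finite G] (hq : IsGeneral G q)
    {H : Subgroup (V n ≃ₗᵢ[ℝ] V n)} (hH : ∀ v ∈ simpleRoots G q, reflection v ∈ H) {v : V n}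
    (hv : v ∈ posRoots G q) : reflection v ∈ H := by
  by_contra hvH
  obtain ⟨w, ⟨hw, hwH⟩, hmin⟩ := Set.exists_min_image {v ∈ posRoots G q | reflection v ∉ H}
    (⟪·, q⟫) (finite_posRoots.subset (Set.sep_subset _ _)) ⟨v, hv, hvH⟩
  obtain ⟨u, hu, hlt, h0, h1⟩ := exists_lower_of_notMem_simpleRoots hq hw (mt (hH w) hwH)
  refine hwH (reflection_mem_of_lower hq hu hw hlt h0 h1 fun x hx hxw => ?_)
  by_contra hxH
  exact hxw.not_ge (hmin x ⟨hx, hxH⟩)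

theorem IsReflectionGroup.le_closure_simpleRoots (hG : IsReflectionGroup G) (hq : IsGeneral G q) :
    G ≤ Subgroup.closure (reflection '' simpleRoots G q) := by
  have := hG.finite
  conv_lhs => rw [← hG.generated]
  rw [Subgroup.closure_le]
  rintro _ ⟨hvG, v, hv, rfl⟩
  obtain ⟨u, hu, huv⟩ := exists_posRoots_reflection_eq hq ⟨hv, hvG⟩
  change reflection v ∈ _
  rw [← huv]
  exact reflection_mem_of_mem_posRoots hq
    (fun w hw => Subgroup.subset_closure (Set.mem_image_of_mem _ hw)) hu

theorem exists_mem_pow_of_mem_closure {Γ : Type*} [Group Γ] {S : Set Γ} (hS : ∀ s ∈ S, s⁻¹ ∈ S)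
    {g : Γ} (hg : g ∈ Subgroup.closure S) : ∃ k : ℕ, g ∈ S ^ k := by
  induction hg using Subgroup.closure_induction'' with
  | one => exact ⟨0, by simp⟩
  | mem s hs => exact ⟨1, by simpa using hs⟩
  | inv_mem s hs => exact ⟨1, by simpa using hS s hs⟩
  | mul x y _ _ hx hy =>
    obtain ⟨k, hk⟩ := hx
    obtain ⟨m, hm⟩ := hy
    exact ⟨k + m, pow_add S k m ▸ Set.mul_mem_mul hk hm⟩

-- The exchange condition.
theorem exists_mul_reflection_mem_pow (hq : IsGeneral G q) {v : V n} (hv : v ∈ posRoots G q)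
    {k : ℕ} {g : V n ≃ₗᵢ[ℝ] V n} (hg : g ∈ (reflection '' simpleRoots G q) ^ k)
    (hneg : ⟪g v, q⟫ < 0) :
    ∃ m, m + 1 = k ∧ g * reflection v ∈ (reflection '' simpleRoots G q) ^ m := by
  induction k generalizing g with
  | zero =>
    obtain rfl : g = 1 := by simpa using hg
    exact absurd hneg hv.2.2.not_gt
  | succ k ih =>
    rw [pow_succ'] at hg
    obtain ⟨_, ⟨a, ha, rfl⟩, g, hg, rfl⟩ := hg
    have hgG : g ∈ G := by
      refine Subgroup.pow_subset ?_ hg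
      rintro _ ⟨b, hb, rfl⟩
      exact hb.1.1.2
    refine ⟨k, rfl, ?_⟩
    rcases lt_or_ge ⟪g v, q⟫ 0 with hlt | hge
    · obtain ⟨m, rfl, hm⟩ := ih hg hlt
      rw [mul_assoc, pow_succ']
      exact Set.mul_mem_mul (Set.mem_image_of_mem _ ha) hm
    · have hgv : g v = a := ha.2 _ (map_mem_posRoots hq hgG hv hge) hneg
      have hcancel : reflection a * g * reflection v = g := by
        rw [← hgv, reflection_map, inv_mul_cancel_right, mul_assoc, reflection_mul_self, mul_one]
      rwa [hcancel]

theorem eq_one_of_forall_posRoots (hq : IsGeneral G q) {k : ℕ} {g : V n ≃ₗᵢ[ℝ] V n}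
    (hg : g ∈ (reflection '' simpleRoots G q) ^ k) (hpos : ∀ v ∈ posRoots G q, 0 < ⟪g v, q⟫) :
    g = 1 := by
  induction k using Nat.strong_induction_on with
  | h k ih =>
    rcases k with _ | k
    · simpa using hg
    · rw [pow_succ] at hg
      obtain ⟨g, hg, _, ⟨v, hv, rfl⟩, rfl⟩ := hg
      have hneg : ⟪g v, q⟫ < 0 := by
        simpa [reflection_self] using hpos v hv.1
      obtain ⟨m, rfl, hm⟩ := exists_mul_reflection_mem_pow hq hv.1 hg hneg
      exact ih m (by omega) hm

theorem IsGeneral.eq_one_of_apply_eq (hG : IsReflectionGroup G) (hq : IsGeneral G q)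
    {g : V n ≃ₗᵢ[ℝ] V n} (hg : g ∈ G) (hgq : g q = q) : g = 1 := by
  have hinv : ∀ s ∈ reflection '' simpleRoots G q, s⁻¹ ∈ reflection '' simpleRoots G q := by
    rintro _ ⟨v, hv, rfl⟩
    exact ⟨v, hv, (reflection_inv v).symm⟩
  obtain ⟨k, hk⟩ := exists_mem_pow_of_mem_closure hinv (hG.le_closure_simpleRoots hq hg)
  refine eq_one_of_forall_posRoots hq hk fun v hv => ?_
  conv_rhs => rw [← hgq]
  rw [g.inner_map_map]
  exact hv.2.2

end SimpleTransitivity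

section Value

open MvPolynomial

@[simp] theorem value_C (c : ℝ) (x : V n) : value (C c) x = c := eval_C c

@[simp] theorem value_X (i : Fin n) (x : V n) : value (X i) x = x i := eval_X i

@[simp] theorem value_add (f g : MvPolynomial (Fin n) ℝ) (x : V n) :
    value (f + g) x = value f x + value g x := map_add _ f g

@[simp] theorem value_sub (f g : MvPolynomial (Fin n) ℝ) (x : V n) :
    value (f - g) x = value f x - value g x := map_sub _ f g

@[simp] theorem value_mul (f g : MvPolynomial (Fin n) ℝ) (x : V n) :
    value (f * g) x = value f x * value g x := map_mul _ f g

@[simp] theorem value_sum {ι : Type*} (s : Finset ι) (f : ι → MvPolynomial (Fin n) ℝ) (x : V n) :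
    value (∑ i ∈ s, f i) x = ∑ i ∈ s, value (f i) x := map_sum _ f s

@[simp] theorem value_prod {ι : Type*} (s : Finset ι) (f : ι → MvPolynomial (Fin n) ℝ) (x : V n) :
    value (∏ i ∈ s, f i) x = ∏ i ∈ s, value (f i) x := map_prod _ f s

theorem value_aeval {σ : Type*} (π : σ → MvPolynomial (Fin n) ℝ) (Q : MvPolynomial σ ℝ) (x : V n) :
    value (aeval π Q) x = eval (fun i => value (π i) x) Q := by
  unfold value
  rw [← aeval_eq_eval, comp_aeval_apply, aeval_eq_eval]

theorem analyticAt_value (f : MvPolynomial (Fin n) ℝ) (x : V n) : AnalyticAt ℝ (value f) x :=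
  AnalyticOnNhd.eval_continuousLinearMap' (fun i => (EuclideanSpace.proj i : V n →L[ℝ] ℝ)) f x
    (Set.mem_univ x)

theorem differentiable_value (f : MvPolynomial (Fin n) ℝ) : Differentiable ℝ (value f) :=
  fun x => (analyticAt_value f x).differentiableAt

theorem hasFDerivAt_value (f : MvPolynomial (Fin n) ℝ) (x : V n) :
    HasFDerivAt (value f) (fderiv ℝ (value f) x) x := (differentiable_value f x).hasFDerivAt

@[simp] theorem fderiv_value_C (c : ℝ) (x : V n) : fderiv ℝ (value (C c)) x = 0 := by
  rw [show value (C c) = fun _ : V n => c from funext (value_C c), fderiv_const_apply]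

theorem fderiv_value_add (f g : MvPolynomial (Fin n) ℝ) (x : V n) :
    fderiv ℝ (value (f + g)) x = fderiv ℝ (value f) x + fderiv ℝ (value g) x := by
  rw [show value (f + g) = value f + value g from funext (value_add f g),
    fderiv_add (differentiable_value f x) (differentiable_value g x)]

theorem fderiv_value_mul (f g : MvPolynomial (Fin n) ℝ) (x : V n) :
    fderiv ℝ (value (f * g)) x =
      value f x • fderiv ℝ (value g) x + value g x • fderiv ℝ (value f) x := by
  rw [show value (f * g) = value f * value g from funext (value_mul f g),
    fderiv_mul (differentiable_value f x) (differentiable_value g x)]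

/-- The polynomial with values given by the linear form `L`. -/
noncomputable def linearPoly (L : V n →L[ℝ] ℝ) : MvPolynomial (Fin n) ℝ :=
  ∑ j, C (L (EuclideanSpace.basisFun (Fin n) ℝ j)) * X j

@[simp] theorem value_linearPoly (L : V n →L[ℝ] ℝ) (x : V n) : value (linearPoly L) x = L x := by
  conv_rhs => rw [← (EuclideanSpace.basisFun (Fin n) ℝ).sum_repr x]
  simp [linearPoly, mul_comm]

/-- The polynomial function `h ∘ T`, as a polynomial. -/
noncomputable def pullback (T : V n →L[ℝ] V n) (h : MvPolynomial (Fin n) ℝ) :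
    MvPolynomial (Fin n) ℝ :=
  aeval (fun i => linearPoly ((EuclideanSpace.proj i : V n →L[ℝ] ℝ) ∘L T)) h

@[simp] theorem value_pullback (T : V n →L[ℝ] V n) (h : MvPolynomial (Fin n) ℝ) (x : V n) :
    value (pullback T h) x = value h (T x) := by
  simp only [pullback, value_aeval, value_linearPoly]
  rfl

end Value

section DifferentialsOfInvariants

open MvPolynomial

theorem exists_value_eq_one_of_notMem {S : Finset (V n)} (hq : q ∉ S) :
    ∃ p : MvPolynomial (Fin n) ℝ, value p q = 1 ∧ ∀ s ∈ S, value p s = 0 := by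
  have hval : ∀ x, value (∏ s ∈ S, C (‖q - s‖ ^ 2)⁻¹ *
      (linearPoly (innerSL ℝ (q - s)) - C ⟪q - s, s⟫)) x =
        ∏ s ∈ S, (‖q - s‖ ^ 2)⁻¹ * ⟪q - s, x - s⟫ := fun x => by
    simp only [value_prod, value_mul, value_C, value_sub, value_linearPoly, innerSL_apply_apply,
      inner_sub_right]
  refine ⟨_, (hval q).trans (Finset.prod_eq_one fun s hs => ?_), fun s hs =>
    (hval s).trans (Finset.prod_eq_zero hs (by simp))⟩
  have hqs : q - s ≠ 0 := sub_ne_zero.2 (ne_of_mem_of_not_mem hs hq).symm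
  rw [real_inner_self_eq_norm_sq, inv_mul_cancel₀ (pow_ne_zero 2 (norm_ne_zero_iff.2 hqs))]

theorem exists_fderiv_value_eq {S : Finset (V n)} (hq : q ∉ S) (L : V n →L[ℝ] ℝ) :
    ∃ h : MvPolynomial (Fin n) ℝ, fderiv ℝ (value h) q = L ∧
      ∀ s ∈ S, fderiv ℝ (value h) s = 0 := by
  obtain ⟨p, hpq, hpS⟩ := exists_value_eq_one_of_notMem hq
  have hL : fderiv ℝ (value (linearPoly L - C (L q))) q = L := by
    rw [show value (linearPoly L - C (L q)) = fun x => L x - L q by ext x; simp,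
      fderiv_sub_const, L.fderiv]
  refine ⟨p * p * (linearPoly L - C (L q)), ?_, fun s hs => ?_⟩
  · simp [fderiv_value_mul, hL, hpq]
  · simp [fderiv_value_mul, hpS s hs]

/-- The sum of the translates of `h` under `G`. -/
noncomputable def orbitSum (G : Subgroup (V n ≃ₗᵢ[ℝ] V n)) [Fintype G]
    (h : MvPolynomial (Fin n) ℝ) : MvPolynomial (Fin n) ℝ :=
  ∑ g : G, pullback (g.1.toContinuousLinearEquiv : V n →L[ℝ] V n) h

theorem value_orbitSum [Fintype G] (h : MvPolynomial (Fin n) ℝ) (x : V n) :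
    value (orbitSum G h) x = ∑ g : G, value h (g.1 x) := by
  simp [orbitSum]

theorem orbitSum_mem_invariants [Fintype G] (h : MvPolynomial (Fin n) ℝ) :
    orbitSum G h ∈ invariants G := by
  intro a ha x
  rw [value_orbitSum, value_orbitSum]
  exact Fintype.sum_equiv (Equiv.mulRight (⟨a, ha⟩ : G)) _ _ fun g => rfl

theorem fderiv_value_orbitSum [Fintype G] (h : MvPolynomial (Fin n) ℝ) (x : V n) :
    fderiv ℝ (value (orbitSum G h)) x =
      ∑ g : G, fderiv ℝ (value h) (g.1 x) ∘L (g.1.toContinuousLinearEquiv : V n →L[ℝ] V n) := by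
  rw [show value (orbitSum G h) = fun y => ∑ g : G, value h (g.1 y) from
    funext (value_orbitSum h)]
  exact (HasFDerivAt.fun_sum fun (g : G) _ => (hasFDerivAt_value h (g.1 x)).comp x
    g.1.toContinuousLinearEquiv.hasFDerivAt).fderiv

theorem exists_invariant_fderiv_eq [Finite G] (hq : ∀ g ∈ G, g q = q → g = 1)
    (L : V n →L[ℝ] ℝ) : ∃ F ∈ invariants G, fderiv ℝ (value F) q = L := by
  classical
  have := Fintype.ofFinite G
  obtain ⟨h, hhq, hh⟩ := exists_fderiv_value_eq
    (Finset.notMem_erase q (Finset.univ.image fun g : G => g.1 q)) L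
  refine ⟨orbitSum G h, orbitSum_mem_invariants h, ?_⟩
  rw [fderiv_value_orbitSum, Finset.sum_eq_single_of_mem (1 : G) (Finset.mem_univ _)]
  · ext x
    simp [hhq]
  · intro g _ hg
    have hgq : g.1 q ≠ q := fun h => hg (Subtype.ext (hq g.1 g.2 h))
    rw [hh _ (Finset.mem_erase.2 ⟨hgq, Finset.mem_image_of_mem _ (Finset.mem_univ g)⟩),
      ContinuousLinearMap.zero_comp]

end DifferentialsOfInvariants

section LocalCoordinates

open scoped Topology

variable {π : Fin n → MvPolynomial (Fin n) ℝ} {i : Fin n}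

theorem IsBasicInvariants.mem_invariants (hπ : IsBasicInvariants G π) (i : Fin n) :
    π i ∈ invariants G :=
  hπ.generates ▸ Algebra.subset_adjoin (Set.mem_range_self i)

theorem fderiv_value_eq_zero_of_mem_adjoin {S : Set (MvPolynomial (Fin n) ℝ)} {w : V n}
    (hS : ∀ p ∈ S, fderiv ℝ (value p) q w = 0) {f : MvPolynomial (Fin n) ℝ}
    (hf : f ∈ Algebra.adjoin ℝ S) : fderiv ℝ (value f) q w = 0 := by
  induction hf using Algebra.adjoin_induction with
  | mem p hp => exact hS p hp
  | algebraMap r => rw [MvPolynomial.algebraMap_eq, fderiv_value_C, _root_.zero_apply]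
  | add a b _ _ ha hb => simp [fderiv_value_add, ha, hb]
  | mul a b _ _ ha hb => simp [fderiv_value_mul, ha, hb]

theorem IsBasicInvariants.injective_fderiv [Finite G] (hπ : IsBasicInvariants G π)
    (hq : ∀ g ∈ G, g q = q → g = 1) :
    Function.Injective (ContinuousLinearMap.pi fun j => fderiv ℝ (value (π j)) q) := by
  rw [injective_iff_map_eq_zero]
  intro w hw
  obtain ⟨F, hF, hFq⟩ := exists_invariant_fderiv_eq hq (innerSL ℝ w)
  have hFw : fderiv ℝ (value F) q w = 0 := by
    refine fderiv_value_eq_zero_of_mem_adjoin (S := Set.range π) ?_ (hπ.generates ▸ hF)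
    rintro _ ⟨j, rfl⟩
    exact congrFun hw j
  rwa [hFq, innerSL_apply_apply, inner_self_eq_zero] at hFw

theorem IsBasicInvariants.range_value_mem_nhds [Finite G] (hπ : IsBasicInvariants G π)
    (hq : ∀ g ∈ G, g q = q → g = 1) :
    Set.range (fun (x : V n) j => value (π j) x) ∈ 𝓝 fun j => value (π j) q := by
  set D := ContinuousLinearMap.pi fun j => fderiv ℝ (value (π j)) q
  have hD : HasStrictFDerivAt (fun (x : V n) j => value (π j) x) D q :=
    hasStrictFDerivAt_pi.2 fun j => (analyticAt_value (π j) q).hasStrictFDerivAt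
  have hsurj : Function.Surjective D :=
    (LinearMap.injective_iff_surjective_of_finrank_eq_finrank (f := D.toLinearMap) (by simp)).1
      (hπ.injective_fderiv hq)
  rw [← hD.map_nhds_eq_of_surj (LinearMap.range_eq_top.2 hsurj)]
  exact Filter.range_mem_map

/-- The coordinate line through `q` when the polynomials `π` are used as coordinates: only `π i`
varies along it. -/
def coordinateLine (π : Fin n → MvPolynomial (Fin n) ℝ) (i : Fin n) (q : V n) : Set (V n) :=
  {x | ∀ j ≠ i, value (π j) x = value (π j) q}

theorem IsBasicInvariants.image_coordinateLine_mem_nhds [Finite G] (hπ : IsBasicInvariants G π)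
    (hq : ∀ g ∈ G, g q = q → g = 1) (i : Fin n) :
    value (π i) '' coordinateLine π i q ∈ 𝓝 (value (π i) q) := by
  set y : Fin n → ℝ := fun j => value (π j) q
  have htendsto : Filter.Tendsto (Function.update y i) (𝓝 (y i)) (𝓝 y) := by
    have hcont : Continuous (Function.update y i) := by fun_prop
    simpa using hcont.tendsto (y i)
  filter_upwards [htendsto (hπ.range_value_mem_nhds hq)]
  rintro t ⟨x, hx⟩
  refine ⟨x, fun j hj => ?_, ?_⟩
  · simpa [hj] using congrFun hx j
  · simpa using congrFun hx i

end LocalCoordinates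

section Degrees

open MvPolynomial

variable {σ τ R : Type*} [CommSemiring R] {d : σ → ℕ} {π : σ → MvPolynomial τ R}

theorem homogeneousComponent_aeval (hπ : ∀ i, (π i).IsHomogeneous (d i)) (k : ℕ)
    (Q : MvPolynomial σ R) :
    homogeneousComponent k (aeval π Q) = aeval π (weightedHomogeneousComponent d k Q) := by
  classical
  induction Q using induction_on' with
  | add P Q hP hQ => simp only [map_add, hP, hQ]
  | monomial m c =>
    have hm : (aeval π (monomial m c)).IsHomogeneous (Finsupp.weight d m) := by
      rw [aeval_monomial, algebraMap_eq, Finsupp.weight_apply]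
      refine (IsHomogeneous.prod _ _ _ fun i _ => ?_).C_mul c
      simpa only [smul_eq_mul, mul_comm] using (hπ i).pow (m i)
    rw [homogeneousComponent_of_mem hm,
      weightedHomogeneousComponent_of_mem (isWeightedHomogeneous_monomial d m c rfl)]
    split_ifs <;> simp

theorem exists_aeval_eq_and_degreeOf_mul_le [Finite σ] (hπ : ∀ i, (π i).IsHomogeneous (d i))
    (Q : MvPolynomial σ R) :
    ∃ P : MvPolynomial σ R, aeval π P = aeval π Q ∧
      ∀ i, degreeOf i P * d i ≤ (aeval π Q).totalDegree := by
  classical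
  have := Fintype.ofFinite σ
  set N := (aeval π Q).totalDegree
  refine ⟨∑ k ∈ Finset.range (N + 1), weightedHomogeneousComponent d k Q, ?_, fun i => ?_⟩
  · simp only [map_sum, ← homogeneousComponent_aeval hπ]
    exact sum_homogeneousComponent _
  · rcases Nat.eq_zero_or_pos (d i) with hi | hi
    · simp [hi]
    rw [← Nat.le_div_iff_mul_le hi, degreeOf_le_iff]
    intro m hm
    rw [Nat.le_div_iff_mul_le hi]
    obtain ⟨k, hk, hne⟩ : ∃ k ∈ Finset.range (N + 1),
        coeff m (weightedHomogeneousComponent d k Q) ≠ 0 :=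
      Finset.exists_ne_zero_of_sum_ne_zero (by rwa [← coeff_sum, ← mem_support_iff])
    have hweight : Finsupp.weight d m = k :=
      weightedHomogeneousComponent_isWeightedHomogeneous k Q hne
    have hle : m i * d i ≤ Finsupp.weight d m := by
      rw [Finsupp.weight_eq_sum]
      exact Finset.single_le_sum (f := fun j => m j • d j) (fun _ _ => Nat.zero_le _)
        (Finset.mem_univ i)
    exact hle.trans (hweight ▸ Nat.lt_succ_iff.1 (Finset.mem_range.1 hk))

end Degrees

section AffineOnCoordinateLines

open MvPolynomial

theorem eval_eq_add_of_degreeOf_le_one {σ R : Type*} [CommRing R] {Q : MvPolynomial σ R} {i : σ}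
    (hQ : degreeOf i Q ≤ 1) {y z : σ → R} (hz : ∀ j ≠ i, z j = y j) :
    eval z Q = eval y Q + (z i - y i) * eval y (pderiv i Q) := by
  classical
  conv_lhs => rw [Q.as_sum]
  conv_rhs => rw [Q.as_sum]
  simp only [map_sum, Finset.mul_sum, ← Finset.sum_add_distrib]
  refine Finset.sum_congr rfl fun m hm => ?_
  have hrest : (m.erase i).prod (fun j k => z j ^ k) = (m.erase i).prod fun j k => y j ^ k :=
    Finset.prod_congr rfl fun j hj => by
      have hji : j ≠ i := by
        rintro rfl
        simp at hj
      simp only [hz j hji]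
  have hsplit (x : σ → R) :
      m.prod (fun j k => x j ^ k) = x i ^ m i * (m.erase i).prod fun j k => x j ^ k :=
    (Finsupp.mul_prod_erase' m i _ fun j => pow_zero (x j)).symm
  rw [pderiv_monomial, eval_monomial, eval_monomial, eval_monomial, hsplit, hsplit, hrest]
  rcases Nat.le_one_iff_eq_zero_or_eq_one.1 (degreeOf_le_iff.1 hQ m hm) with hmi | hmi
  · simp [hmi]
  · have herase : m - Finsupp.single i 1 = m.erase i := by
      ext j
      rcases eq_or_ne j i with rfl | hj
      · simp [hmi]
      · simp [hj]
    rw [herase, hmi]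
    ring

variable {π : Fin n → MvPolynomial (Fin n) ℝ} {f : MvPolynomial (Fin n) ℝ} {i : Fin n}

theorem IsBasicInvariants.exists_aeval_eq (hπ : IsBasicInvariants G π) (hf : f ∈ invariants G) :
    ∃ P : MvPolynomial (Fin n) ℝ, aeval π P = f ∧
      ∀ i, degreeOf i P * (π i).totalDegree ≤ f.totalDegree := by
  rw [← hπ.generates, Algebra.adjoin_range_eq_range_aeval] at hf
  obtain ⟨Q, rfl⟩ := hf
  exact exists_aeval_eq_and_degreeOf_mul_le hπ.homogeneous Q

theorem IsBasicInvariants.exists_affine_on_coordinateLine (hπ : IsBasicInvariants G π)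
    (hf : f ∈ invariants G) (hd : f.totalDegree < 2 * (π i).totalDegree) (q : V n) :
    ∃ b : ℝ, ∀ x ∈ coordinateLine π i q,
      value f x = value f q + (value (π i) x - value (π i) q) * b := by
  obtain ⟨P, rfl, hdeg⟩ := hπ.exists_aeval_eq hf
  have hP : degreeOf i P ≤ 1 :=
    Nat.lt_succ_iff.1 (lt_of_mul_lt_mul_right ((hdeg i).trans_lt hd) (Nat.zero_le _))
  refine ⟨eval (fun j => value (π j) q) (pderiv i P), fun x hx => ?_⟩
  rw [value_aeval, value_aeval, eval_eq_add_of_degreeOf_le_one hP hx]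

theorem IsBasicInvariants.value_eq_of_mem_coordinateLine (hπ : IsBasicInvariants G π)
    (hf : f ∈ invariants G) (hd : f.totalDegree < (π i).totalDegree) {x : V n}
    (hx : x ∈ coordinateLine π i q) : value f x = value f q := by
  obtain ⟨P, rfl, hdeg⟩ := hπ.exists_aeval_eq hf
  have hP : degreeOf i P = 0 := by
    have := lt_of_mul_lt_mul_right (((hdeg i).trans_lt hd).trans_eq (one_mul _).symm)
      (Nat.zero_le _)
    omega
  rw [value_aeval, value_aeval]
  refine eval₂Hom_congr' rfl (fun j hj _ => hx j ?_) rfl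
  rintro rfl
  exact mem_vars_iff_degreeOf_ne_zero.1 hj hP

end AffineOnCoordinateLines

section Extrema

open MvPolynomial
open scoped Topology

/-- The squared norm, as a polynomial. -/
noncomputable def normSq (n : ℕ) : MvPolynomial (Fin n) ℝ := ∑ i, X i ^ 2

@[simp] theorem value_normSq (x : V n) : value (normSq n) x = ‖x‖ ^ 2 := by
  rw [EuclideanSpace.real_norm_sq_eq]
  simp [normSq, sq]

theorem normSq_mem_invariants : normSq n ∈ invariants G := fun g _ x => by
  rw [value_normSq, value_normSq, g.norm_map]

theorem totalDegree_normSq_le : (normSq n).totalDegree ≤ 2 :=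
  (IsHomogeneous.sum _ _ 2 fun i _ => isHomogeneous_X_pow i 2).totalDegree_le

/-- The extreme points of `f` on the sphere of radius `r`. -/
def sphereExtrema (f : MvPolynomial (Fin n) ℝ) (r : ℝ) : Set (V n) :=
  {x | x ∈ Metric.sphere 0 r ∧ IsExtrOn (value f) (Metric.sphere 0 r) x}

variable {f : MvPolynomial (Fin n) ℝ} {r : ℝ}

theorem mem_sphereExtrema_of_value_eq {x : V n} (hq : q ∈ sphereExtrema f r)
    (hx : x ∈ Metric.sphere 0 r) (h : value f x = value f q) : x ∈ sphereExtrema f r := by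
  refine ⟨hx, hq.2.imp (fun hmin => ?_) fun hmax => ?_⟩
  · simpa only [IsMinOn, IsMinFilter, h] using hmin
  · simpa only [IsMaxOn, IsMaxFilter, h] using hmax

variable {π : Fin n → MvPolynomial (Fin n) ℝ} {i : Fin n}

theorem IsBasicInvariants.coordinateLine_subset_sphere (hπ : IsBasicInvariants G π)
    (hi : 2 < (π i).totalDegree) (hq : q ∈ Metric.sphere 0 r) :
    coordinateLine π i q ⊆ Metric.sphere 0 r := fun x hx => by
  have h := hπ.value_eq_of_mem_coordinateLine normSq_mem_invariants
    (totalDegree_normSq_le.trans_lt hi) hx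
  rw [mem_sphere_zero_iff_norm] at hq ⊢
  rwa [value_normSq, value_normSq, sq_eq_sq₀ (norm_nonneg _) (norm_nonneg _), hq] at h

theorem IsBasicInvariants.infinite_sphereExtrema [Finite G] (hπ : IsBasicInvariants G π)
    (hfree : ∀ g ∈ G, g q = q → g = 1) (hi : 2 < (π i).totalDegree) {b : ℝ}
    (hf : ∀ x ∈ coordinateLine π i q,
      value f x = value f q + (value (π i) x - value (π i) q) * b)
    (hq : q ∈ sphereExtrema f r) : (sphereExtrema f r).Infinite := by
  have hsphere := hπ.coordinateLine_subset_sphere hi hq.1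
  have himage := hπ.image_coordinateLine_mem_nhds hfree i
  have hderiv : HasDerivAt (fun t => value f q + (t - value (π i) q) * b) b (value (π i) q) := by
    simpa using (((hasDerivAt_id _).sub_const (value (π i) q)).mul_const b).const_add (value f q)
  have hextr : IsLocalExtr (fun t => value f q + (t - value (π i) q) * b) (value (π i) q) := by
    refine hq.2.imp (fun hmin => ?_) fun hmax => ?_
    · filter_upwards [himage]
      rintro _ ⟨x, hx, rfl⟩
      simpa [hf x hx] using hmin (hsphere hx)
    · filter_upwards [himage]
      rintro _ ⟨x, hx, rfl⟩
      simpa [hf x hx] using hmax (hsphere hx)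
  have hb : b = 0 := hextr.hasDerivAt_eq_zero hderiv
  refine ((infinite_of_mem_nhds _ himage).of_image _).mono fun x hx => ?_
  exact mem_sphereExtrema_of_value_eq hq (hsphere hx) (by rw [hf x hx, hb, mul_zero, add_zero])

theorem mem_stratum_finrank (G : Subgroup (V n ≃ₗᵢ[ℝ] V n)) (p : V n) : p ∈ stratum G n :=
  ⟨⊤, ⟨∅, Set.empty_subset _, sInf_empty.symm⟩, by simp, trivial⟩

theorem strNum_spec {d : ℕ} (hq : q ∉ stratum G (strNum G d)) :
    ∃ G' ≤ G, IsReflectionGroup G' ∧ IsGeneral G' q ∧ LtTwiceTopDegree d G' :=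
  Nat.sInf_mem (s := {ℓ : ℕ | ∀ p : V n, p ∉ stratum G ℓ →
    ∃ G' ≤ G, IsReflectionGroup G' ∧ IsGeneral G' p ∧ LtTwiceTopDegree d G'})
    ⟨n, fun p hp => absurd (mem_stratum_finrank G p) hp⟩ q hq

theorem strNum_le (G : Subgroup (V n ≃ₗᵢ[ℝ] V n)) (d : ℕ) : strNum G d ≤ n :=
  Nat.sInf_le fun p hp => absurd (mem_stratum_finrank G p) hp

theorem invariants_anti {G' : Subgroup (V n ≃ₗᵢ[ℝ] V n)} (h : G' ≤ G) :
    invariants G ≤ invariants G' :=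
  fun _ hf g hg => hf g (h hg)

theorem sphereExtrema_subset_stratum_strNum (hf : f ∈ invariants G) (hd : 4 ≤ f.totalDegree)
    (hfin : (sphereExtrema f r).Finite) :
    sphereExtrema f r ⊆ stratum G (strNum G f.totalDegree) := by
  intro q hq
  by_contra hqs
  obtain ⟨G', hle, hG', hgen, π, hπ, i, -, hi⟩ := strNum_spec hqs
  have := hG'.finite
  obtain ⟨b, hb⟩ := hπ.exists_affine_on_coordinateLine (invariants_anti hle hf) hi q
  exact hπ.infinite_sphereExtrema (fun _ => hgen.eq_one_of_apply_eq hG') (by omega) hb hq hfin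

theorem sphereExtrema_subset_stratum_strNum_two_mul {S : Set (MvPolynomial (Fin n) ℝ)} {d : ℕ}
    (hd : 2 ≤ d) (hS : ∀ p ∈ S, p ∈ invariants G ∧ p.totalDegree ≤ d)
    (hf : f ∈ Algebra.adjoin ℝ S) (hfin : (sphereExtrema f r).Finite) :
    sphereExtrema f r ⊆ stratum G (strNum G (2 * d)) := by
  intro q hq
  by_contra hqs
  obtain ⟨G', hle, hG', hgen, π, hπ, i, -, hi⟩ := strNum_spec hqs
  have := hG'.finite
  have hconst (x : V n) (hx : x ∈ coordinateLine π i q) : value f x = value f q := by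
    have hSle : S ⊆ (AlgHom.equalizer (aeval x.ofLp) (aeval q.ofLp) :
        Subalgebra ℝ (MvPolynomial (Fin n) ℝ)) := fun p hp =>
      hπ.value_eq_of_mem_coordinateLine (invariants_anti hle (hS p hp).1)
        ((hS p hp).2.trans_lt (by omega)) hx
    exact Algebra.adjoin_le hSle hf
  exact hπ.infinite_sphereExtrema (i := i) (b := 0) (fun _ => hgen.eq_one_of_apply_eq hG')
    (by omega) (fun x hx => by rw [hconst x hx, mul_zero, add_zero]) hq hfin

end Extrema

section SpanningRoots

theorem exists_isRoot_inner_ne_zero (hspan : Submodule.span ℝ {v | IsRoot G v} = ⊤) {x : V n}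
    (hx : x ≠ 0) : ∃ v, IsRoot G v ∧ ⟪v, x⟫ ≠ 0 := by
  by_contra! h
  have hle : Submodule.span ℝ {v | IsRoot G v} ≤ (ℝ ∙ x)ᗮ := Submodule.span_le.2 fun v hv =>
    Submodule.mem_orthogonal_singleton_iff_inner_left.2 (h v hv)
  rw [hspan, top_le_iff, Submodule.orthogonal_eq_top_iff, Submodule.span_singleton_eq_bot] at hle
  exact hx hle

theorem span_roots_eq_top (hgen : Subgroup.closure {g | g ∈ G ∧ IsReflection g} = G)
    (hess : IsEssential G) : Submodule.span ℝ {v | IsRoot G v} = ⊤ := by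
  rw [← Submodule.orthogonal_eq_bot_iff, Submodule.eq_bot_iff]
  intro x hx
  refine hess x fun g hg => ?_
  rw [← hgen] at hg
  induction hg using Subgroup.closure_induction with
  | mem g hg =>
    obtain ⟨hgG, v, hv, rfl⟩ := hg
    have hroot : IsRoot G v := ⟨hv, hgG⟩
    exact reflection_apply_eq_self
      (Submodule.inner_right_of_mem_orthogonal (Submodule.subset_span hroot) hx)
  | one => rfl
  | mul a b _ _ ha hb => rw [LinearIsometryEquiv.coe_mul, Function.comp_apply, hb, ha]
  | inv a _ ha => exact a.symm_apply_eq.2 ha.symm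

theorem IsFlat.inf_hyperplane {F : Submodule ℝ (V n)} (hF : IsFlat G F) {v : V n}
    (hv : IsRoot G v) : IsFlat G (F ⊓ hyperplane v) := by
  obtain ⟨S, hS, rfl⟩ := hF
  refine ⟨insert (hyperplane v) S, ?_, by rw [sInf_insert, inf_comm]⟩
  rintro H (rfl | hH)
  · exact ⟨v, hv.1, hv.2, rfl⟩
  · exact hS hH

theorem finrank_inf_hyperplane {F : Submodule ℝ (V n)} {v x : V n} (hx : x ∈ F)
    (h : ⟪v, x⟫ ≠ 0) :
    Module.finrank ℝ (F ⊓ hyperplane v : Submodule ℝ (V n)) + 1 = Module.finrank ℝ F := by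
  have hφ : (innerSL ℝ v).toLinearMap ∘ₗ F.subtype ≠ 0 := fun h0 =>
    h (by simpa using LinearMap.congr_fun h0 ⟨x, hx⟩)
  have hker : LinearMap.ker (innerSL ℝ v).toLinearMap = hyperplane v := by
    ext y
    simp [mem_hyperplane]
  rw [← Module.Dual.finrank_ker_add_one_of_ne_zero hφ, LinearMap.ker_comp,
    ← Submodule.finrank_map_subtype_eq, Submodule.map_comap_subtype, hker]

theorem exists_isFlat_finrank_eq (hspan : Submodule.span ℝ {v | IsRoot G v} = ⊤) {k : ℕ}
    (hk : k ≤ n) : ∃ F, IsFlat G F ∧ Module.finrank ℝ F = k := by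
  induction hk using Nat.decreasingInduction with
  | self => exact ⟨⊤, ⟨∅, Set.empty_subset _, sInf_empty.symm⟩, by simp⟩
  | of_succ k _ ih =>
    obtain ⟨F, hF, hrank⟩ := ih
    have hne : F ≠ ⊥ := by
      rintro rfl
      simp at hrank
    obtain ⟨x, hx, hx0⟩ := Submodule.exists_mem_ne_zero_of_ne_bot hne
    obtain ⟨v, hv, hvx⟩ := exists_isRoot_inner_ne_zero hspan hx0
    exact ⟨_, hF.inf_hyperplane hv, by linarith [finrank_inf_hyperplane hx hvx]⟩

theorem zero_mem_stratum (hspan : Submodule.span ℝ {v | IsRoot G v} = ⊤) {k : ℕ} (hk : k ≤ n) :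
    (0 : V n) ∈ stratum G k := by
  obtain ⟨F, hF, hrank⟩ := exists_isFlat_finrank_eq hspan hk
  exact ⟨F, hF, hrank, F.zero_mem⟩

end SpanningRoots

section LineRestrictions

open MvPolynomial

/-- The derivative in the direction `v`, as a derivation of the polynomial ring. -/
noncomputable def dirDeriv (v : V n) :
    Derivation ℝ (MvPolynomial (Fin n) ℝ) (MvPolynomial (Fin n) ℝ) :=
  mkDerivation ℝ fun i => C (v i)

/-- The polynomial function `s ↦ f (x + s v)` of one variable, as a polynomial. -/
noncomputable def lineRestriction (f : MvPolynomial (Fin n) ℝ) (x v : V n) : Polynomial ℝ :=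
  aeval (fun i => Polynomial.C (x i) + Polynomial.C (v i) * Polynomial.X) f

variable {f : MvPolynomial (Fin n) ℝ} {x v w : V n}

theorem totalDegree_dirDeriv_le (v : V n) (f : MvPolynomial (Fin n) ℝ) :
    (dirDeriv v f).totalDegree ≤ f.totalDegree - 1 := by
  rw [f.as_sum, map_sum]
  refine totalDegree_finsetSum_le fun m hm => ?_
  rw [← f.as_sum, dirDeriv, mkDerivation_monomial]
  refine (totalDegree_smul_le _ _).trans (totalDegree_finsetSum_le fun i hi => ?_)
  calc (monomial (m - Finsupp.single i 1) (m i : ℝ) • C (v i)).totalDegree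
    _ ≤ (monomial (m - Finsupp.single i 1) (m i : ℝ)).totalDegree + (C (v i)).totalDegree :=
      totalDegree_mul _ _
    _ ≤ (m - Finsupp.single i 1).degree := by
      rw [totalDegree_C, add_zero]
      exact totalDegree_monomial_le _ _
    _ = m.degree - 1 := by
      have h := congrArg Finsupp.degree
        (Finsupp.sub_add_single_one_cancel (Finsupp.mem_support_iff.1 hi))
      rw [map_add, Finsupp.degree_single] at h
      omega
    _ ≤ f.totalDegree - 1 := Nat.sub_le_sub_right (le_totalDegree hm) 1

theorem eval_lineRestriction (f : MvPolynomial (Fin n) ℝ) (x v : V n) (s : ℝ) :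
    (lineRestriction f x v).eval s = value f (x + s • v) := by
  rw [lineRestriction, ← Polynomial.coe_aeval_eq_eval, comp_aeval_apply, aeval_eq_eval, value]
  congr 2
  ext i
  simp only [map_add, map_mul, Polynomial.aeval_C, Polynomial.aeval_X]
  simp [mul_comm]

theorem natDegree_lineRestriction_le (f : MvPolynomial (Fin n) ℝ) (x v : V n) :
    (lineRestriction f x v).natDegree ≤ f.totalDegree :=
  (aeval_natDegree_le f le_rfl _ fun i => by compute_degree).trans_eq (mul_one _)

theorem derivative_lineRestriction (f : MvPolynomial (Fin n) ℝ) (x v : V n) :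
    Polynomial.derivative (lineRestriction f x v) = lineRestriction (dirDeriv v f) x v := by
  induction f using MvPolynomial.induction_on with
  | C a => simp [lineRestriction]
  | add f g hf hg =>
    simp only [lineRestriction, map_add] at hf hg ⊢
    rw [hf, hg]
  | mul_X f i hf =>
    simp only [lineRestriction] at hf
    simp only [lineRestriction, map_mul, aeval_X, Derivation.leibniz, smul_eq_mul, map_add,
      Polynomial.derivative_mul, hf]
    simp [dirDeriv]
    ring

theorem coeff_lineRestriction_zero (f : MvPolynomial (Fin n) ℝ) (x v : V n) :
    (lineRestriction f x v).coeff 0 = value f x := by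
  rw [Polynomial.coeff_zero_eq_eval_zero, eval_lineRestriction, zero_smul, add_zero]

theorem coeff_lineRestriction_one (f : MvPolynomial (Fin n) ℝ) (x v : V n) :
    (lineRestriction f x v).coeff 1 = value (dirDeriv v f) x := by
  rw [← coeff_lineRestriction_zero _ x v, ← derivative_lineRestriction, Polynomial.coeff_derivative]
  simp

theorem coeff_lineRestriction_two (f : MvPolynomial (Fin n) ℝ) (x v : V n) :
    (lineRestriction f x v).coeff 2 = value (dirDeriv v (dirDeriv v f)) x / 2 := by
  rw [← coeff_lineRestriction_one _ x v, ← derivative_lineRestriction, Polynomial.coeff_derivative]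
  norm_num

theorem value_dirDeriv (f : MvPolynomial (Fin n) ℝ) (x v : V n) :
    value (dirDeriv v f) x = fderiv ℝ (value f) x v := by
  have hline : HasDerivAt (fun s : ℝ => x + s • v) v 0 := by
    simpa using ((hasDerivAt_id (0 : ℝ)).smul_const v).const_add x
  have hvalue : HasFDerivAt (value f) (fderiv ℝ (value f) x) (x + (0 : ℝ) • v) := by
    simpa using hasFDerivAt_value f x
  have hpoly := (lineRestriction f x v).hasDerivAt 0
  rw [derivative_lineRestriction, eval_lineRestriction, zero_smul, add_zero] at hpoly
  simp only [eval_lineRestriction] at hpoly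
  have hcomp : HasDerivAt (fun s : ℝ => value f (x + s • v)) (fderiv ℝ (value f) x v) 0 :=
    HasFDerivAt.comp_hasDerivAt (f := fun s : ℝ => x + s • v) (0 : ℝ) hvalue hline
  exact hpoly.unique hcomp

theorem value_add_of_totalDegree_le_one (hf : f.totalDegree ≤ 1) (x v : V n) :
    value f (x + v) = value f x + fderiv ℝ (value f) x v := by
  rw [← coeff_lineRestriction_zero f x v, ← value_dirDeriv, ← coeff_lineRestriction_one]
  have h := eval_lineRestriction f x v 1
  rw [one_smul, Polynomial.eval_eq_sum_range'
    (Nat.lt_succ_of_le ((natDegree_lineRestriction_le f x v).trans hf))] at h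
  simpa [Finset.sum_range_succ] using h.symm

theorem fderiv_value_map (hf : f ∈ invariants G) {g : V n ≃ₗᵢ[ℝ] V n} (hg : g ∈ G) (x w : V n) :
    fderiv ℝ (value f) (g x) (g w) = fderiv ℝ (value f) x w := by
  have h := (hasFDerivAt_value f (g x)).comp x g.toContinuousLinearEquiv.hasFDerivAt
  rw [show value f ∘ g = value f from funext (hf g hg)] at h
  rw [h.fderiv]
  rfl

theorem value_eq_of_totalDegree_le_one (hspan : Submodule.span ℝ {v | IsRoot G v} = ⊤)
    (hf : f ∈ invariants G) (hd : f.totalDegree ≤ 1) (x : V n) : value f x = value f 0 := by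
  have hle : Submodule.span ℝ {v | IsRoot G v} ≤
      LinearMap.ker (fderiv ℝ (value f) 0).toLinearMap := Submodule.span_le.2 fun v hv => by
    have h := fderiv_value_map hf hv.2 0 v
    rw [map_zero, reflection_self, map_neg] at h
    exact LinearMap.mem_ker.2 (by simpa using (self_eq_neg.1 h.symm))
  have hfx := value_add_of_totalDegree_le_one hd 0 x
  have hx : fderiv ℝ (value f) 0 x = 0 := hle (hspan ▸ Submodule.mem_top)
  rwa [zero_add, hx, add_zero] at hfx

theorem IsBasicInvariants.two_le_totalDegree (hspan : Submodule.span ℝ {v | IsRoot G v} = ⊤)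
    {π : Fin n → MvPolynomial (Fin n) ℝ} (hπ : IsBasicInvariants G π) (k : Fin n) :
    2 ≤ (π k).totalDegree := by
  by_contra! hlt
  have hconst : π k = C (value (π k) 0) := MvPolynomial.funext fun y => by
    rw [eval_C, ← value_eq_of_totalDegree_le_one hspan (hπ.mem_invariants k) (by omega)
      (WithLp.toLp 2 y)]
    rfl
  exact hπ.algebraicIndependent.transcendental k (hconst ▸ isAlgebraic_algebraMap _)

end LineRestrictions

section Cubics

open MvPolynomial

variable {f : MvPolynomial (Fin n) ℝ} {α β v x : V n} {r : ℝ}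

theorem coeff_eq_of_eval_symm {p : Polynomial ℝ} (hp : p.natDegree ≤ 3) {c : ℝ}
    (h : ∀ s, p.eval (-s - c) = p.eval s) : p.coeff 1 = c * p.coeff 2 ∧ p.coeff 3 = 0 := by
  simp only [Polynomial.eval_eq_sum_range' (Nat.lt_succ_of_le hp), Finset.sum_range_succ,
    Finset.sum_range_zero] at h
  have h₁ := h (1 - c / 2)
  have h₂ := h (2 - c / 2)
  have h₃ : p.coeff 3 = 0 := by linear_combination (2 * h₁ - h₂) / 12
  refine ⟨?_, h₃⟩
  rw [h₃] at h₁
  linear_combination -h₁ / 2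

theorem reflection_add_smul (v x : V n) (s : ℝ) :
    reflection v (x + s • v) = x + (-s - 2 * ⟪v, x⟫ / ‖v‖ ^ 2) • v := by
  rw [map_add, map_smul, reflection_self, reflection_apply]
  module

theorem coeff_lineRestriction_of_isRoot (hf : f ∈ invariants G) (hd : f.totalDegree ≤ 3)
    (hv : IsRoot G v) (x : V n) :
    (lineRestriction f x v).coeff 1 =
        2 * ⟪v, x⟫ / ‖v‖ ^ 2 * (lineRestriction f x v).coeff 2 ∧
      (lineRestriction f x v).coeff 3 = 0 :=
  coeff_eq_of_eval_symm ((natDegree_lineRestriction_le f x v).trans hd) fun s => by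
    rw [eval_lineRestriction, eval_lineRestriction, ← reflection_add_smul, hf _ hv.2]

theorem value_dirDeriv_dirDeriv_eq_zero (hf : f ∈ invariants G) (hd : f.totalDegree ≤ 3)
    (hv : IsRoot G v) (hx : fderiv ℝ (value f) x = 0) (hvx : ⟪v, x⟫ ≠ 0) :
    value (dirDeriv v (dirDeriv v f)) x = 0 := by
  have h := (coeff_lineRestriction_of_isRoot hf hd hv x).1
  rw [coeff_lineRestriction_one, coeff_lineRestriction_two, value_dirDeriv, hx,
    _root_.zero_apply] at h
  have := norm_ne_zero_iff.2 hv.1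
  simpa [hvx, this] using h

theorem value_add_smul_of_dirDeriv_dirDeriv_eq_zero (hf : f ∈ invariants G)
    (hd : f.totalDegree ≤ 3) (hv : IsRoot G v) (hx : value (dirDeriv v (dirDeriv v f)) x = 0)
    (s : ℝ) : value f (x + s • v) = value f x := by
  obtain ⟨h₁, h₃⟩ := coeff_lineRestriction_of_isRoot hf hd hv x
  have h₂ : (lineRestriction f x v).coeff 2 = 0 := by
    rw [coeff_lineRestriction_two, hx, zero_div]
  rw [← eval_lineRestriction, Polynomial.eval_eq_sum_range'
    (Nat.lt_succ_of_le ((natDegree_lineRestriction_le f x v).trans hd))]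
  simp [Finset.sum_range_succ, h₁, h₂, h₃, coeff_lineRestriction_zero]

-- The second derivative along `α` is affine, and it vanishes both at `q` and at its mirror
-- image in `β`, hence on the whole line `q + ℝ β`.
theorem value_dirDeriv_dirDeriv_add_smul_eq_zero (hf : f ∈ invariants G)
    (hd : f.totalDegree ≤ 3) (hα : IsRoot G α) (hβ : IsRoot G β) (hαq : ⟪α, q⟫ ≠ 0)
    (hβq : ⟪β, q⟫ ≠ 0) (hαβq : ⟪reflection β α, q⟫ ≠ 0) (hcrit : fderiv ℝ (value f) q = 0)
    (t : ℝ) : value (dirDeriv α (dirDeriv α f)) (q + t • β) = 0 := by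
  have hcrit' : fderiv ℝ (value f) (reflection β q) = 0 := by
    ext w
    have h := fderiv_value_map hf hβ.2 q ((reflection β).symm w)
    rwa [LinearIsometryEquiv.apply_symm_apply, hcrit] at h
  have hαq' : ⟪α, reflection β q⟫ ≠ 0 := by
    rwa [← (reflection β).inner_map_map,
      show reflection β (reflection β q) = q from Submodule.reflection_reflection _ q]
  have hle : (dirDeriv α (dirDeriv α f)).totalDegree ≤ 1 := by
    have h₁ := totalDegree_dirDeriv_le α f
    have h₂ := totalDegree_dirDeriv_le α (dirDeriv α f)
    omega
  have hq := value_dirDeriv_dirDeriv_eq_zero hf hd hα hcrit hαq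
  have hβq₀ := value_dirDeriv_dirDeriv_eq_zero hf hd hα hcrit' hαq'
  have := norm_ne_zero_iff.2 hβ.1
  rw [reflection_apply, sub_eq_add_neg, ← neg_smul, value_add_of_totalDegree_le_one hle, hq,
    map_smul, smul_eq_mul, zero_add, mul_eq_zero] at hβq₀
  rw [value_add_of_totalDegree_le_one hle, hq, map_smul, hβq₀.resolve_left (by simp [hβq, this]),
    smul_zero, add_zero]

theorem value_add_smul_add_smul (hf : f ∈ invariants G) (hd : f.totalDegree ≤ 3)
    (hα : IsRoot G α) (hβ : IsRoot G β) (hαq : ⟪α, q⟫ ≠ 0) (hβq : ⟪β, q⟫ ≠ 0)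
    (hαβq : ⟪reflection β α, q⟫ ≠ 0) (hcrit : fderiv ℝ (value f) q = 0) (s t : ℝ) :
    value f (q + t • β + s • α) = value f q := by
  rw [value_add_smul_of_dirDeriv_dirDeriv_eq_zero hf hd hα
      (value_dirDeriv_dirDeriv_add_smul_eq_zero hf hd hα hβ hαq hβq hαβq hcrit t),
    value_add_smul_of_dirDeriv_dirDeriv_eq_zero hf hd hβ
      (value_dirDeriv_dirDeriv_eq_zero hf hd hβ hcrit hβq)]

-- `l` is the Lagrange multiplier of the constraint `‖x‖² = r²`.
theorem exists_fderiv_sub_normSq_eq_zero (hq0 : q ≠ 0) (hq : q ∈ sphereExtrema f r) :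
    ∃ l : ℝ, fderiv ℝ (value (f - C l * normSq n)) q = 0 := by
  have hsphere : Metric.sphere (0 : V n) r = {x | ‖x‖ ^ 2 = ‖q‖ ^ 2} := by
    ext x
    rw [← mem_sphere_zero_iff_norm.1 hq.1, mem_sphere_zero_iff_norm, Set.mem_ofPred_eq,
      sq_eq_sq₀ (norm_nonneg _) (norm_nonneg _)]
  have hextr := hq.2
  rw [hsphere] at hextr
  have hnorm := hasStrictFDerivAt_norm_sq (F := V n) q
  obtain ⟨a, b, hab, h⟩ := IsLocalExtrOn.exists_multipliers_of_hasStrictFDerivAt_1d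
    (f := fun x : V n => ‖x‖ ^ 2) hextr.localize hnorm (analyticAt_value f q).hasStrictFDerivAt
  have hb : b ≠ 0 := by
    rintro rfl
    have ha : a = 0 := by simpa [hq0] using congrArg (fun T : V n →L[ℝ] ℝ => T q) h
    exact hab (by rw [ha]; rfl)
  refine ⟨-a / b, ?_⟩
  have hvalue : value (f - C (-a / b) * normSq n) = fun x => value f x - -a / b * ‖x‖ ^ 2 := by
    ext x
    simp
  rw [hvalue, ((hasFDerivAt_value f q).fun_sub (hnorm.hasFDerivAt.const_mul (-a / b))).fderiv]
  refine (smul_eq_zero.1 (?_ : b • _ = (0 : V n →L[ℝ] ℝ))).resolve_left hb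
  rw [smul_sub, smul_smul, mul_div_cancel₀ _ hb, ← h]
  module

theorem injOn_reflection_pencil (hind : LinearIndependent ℝ ![α, β]) :
    Set.InjOn (fun c : ℝ => reflection (α + c • β) q) {c | ⟪α + c • β, q⟫ ≠ 0} := by
  intro c hc e _ hce
  simp only [reflection_apply, sub_right_inj, smul_add, smul_smul] at hce
  obtain ⟨h₁, h₂⟩ := hind.eq_of_pair hce
  have hne : α + c • β ≠ 0 := fun h => hc (by rw [h, inner_zero_left])
  have hcoeff : 2 * ⟪α + c • β, q⟫ / ‖α + c • β‖ ^ 2 ≠ 0 :=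
    div_ne_zero (mul_ne_zero two_ne_zero hc) (pow_ne_zero 2 (norm_ne_zero_iff.2 hne))
  rw [← h₁] at h₂
  exact mul_left_cancel₀ hcoeff h₂

theorem infinite_reflection_pencil (hind : LinearIndependent ℝ ![α, β]) (hβq : ⟪β, q⟫ ≠ 0) :
    (Set.range fun c : ℝ => reflection (α + c • β) q).Infinite := by
  have hcompl : {c : ℝ | ⟪α + c • β, q⟫ ≠ 0} = {-⟪α, q⟫ / ⟪β, q⟫}ᶜ := by
    ext c
    rw [Set.mem_ofPred_eq, inner_add_left, real_inner_smul_left, Set.mem_compl_singleton_iff, ne_eq,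
      ne_eq, eq_div_iff hβq, eq_neg_iff_add_eq_zero, add_comm]
  have hinf : {c : ℝ | ⟪α + c • β, q⟫ ≠ 0}.Infinite := by
    rw [hcompl]
    exact (Set.finite_singleton _).infinite_compl
  exact (hinf.image (injOn_reflection_pencil hind)).mono (Set.image_subset_range _ _)

theorem infinite_sphereExtrema_of_totalDegree_le_three (hf : f ∈ invariants G)
    (hd : f.totalDegree ≤ 3) (hα : IsRoot G α) (hβ : IsRoot G β)
    (hind : LinearIndependent ℝ ![α, β]) (hαq : ⟪α, q⟫ ≠ 0) (hβq : ⟪β, q⟫ ≠ 0)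
    (hαβq : ⟪reflection β α, q⟫ ≠ 0) (hq : q ∈ sphereExtrema f r) :
    (sphereExtrema f r).Infinite := by
  have hq0 : q ≠ 0 := fun h => hαq (by rw [h, inner_zero_right])
  obtain ⟨l, hcrit⟩ := exists_fderiv_sub_normSq_eq_zero hq0 hq
  have hinv : f - C l * normSq n ∈ invariants G :=
    sub_mem hf (mul_mem (Subalgebra.algebraMap_mem _ l) normSq_mem_invariants)
  have hdeg : (f - C l * normSq n).totalDegree ≤ 3 := by
    refine (totalDegree_sub _ _).trans (max_le hd ((totalDegree_mul _ _).trans ?_))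
    rw [totalDegree_C, zero_add]
    exact totalDegree_normSq_le.trans (by norm_num)
  refine (infinite_reflection_pencil hind hβq).mono ?_
  rintro _ ⟨c, rfl⟩
  have hnorm : ‖reflection (α + c • β) q‖ = ‖q‖ := (reflection _).norm_map q
  refine mem_sphereExtrema_of_value_eq hq ?_ ?_
  · rw [mem_sphere_zero_iff_norm, hnorm, ← mem_sphere_zero_iff_norm]
    exact hq.1
  · set k := 2 * ⟪α + c • β, q⟫ / ‖α + c • β‖ ^ 2 with hk
    have happly : reflection (α + c • β) q = q + (-k * c) • β + (-k) • α := by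
      rw [reflection_apply, ← hk]
      module
    have h := value_add_smul_add_smul hinv hdeg hα hβ hαq hβq hαβq hcrit (-k) (-k * c)
    rw [← happly] at h
    simpa [hnorm] using h

end Cubics

section FirstStratum

/-- The smallest flat of `G` that contains `q`. -/
noncomputable def flatThrough (G : Subgroup (V n ≃ₗᵢ[ℝ] V n)) (q : V n) : Submodule ℝ (V n) :=
  sInf {H ∈ arrangement G | q ∈ H}

theorem isFlat_flatThrough (G : Subgroup (V n ≃ₗᵢ[ℝ] V n)) (q : V n) :
    IsFlat G (flatThrough G q) :=
  ⟨_, Set.sep_subset _ _, rfl⟩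

theorem self_mem_flatThrough (G : Subgroup (V n ≃ₗᵢ[ℝ] V n)) (q : V n) : q ∈ flatThrough G q :=
  Submodule.mem_sInf.2 fun _ hH => hH.2

theorem inner_eq_zero_of_mem_flatThrough {v x : V n} (hv : IsRoot G v) (hvq : ⟪v, q⟫ = 0)
    (hx : x ∈ flatThrough G q) : ⟪v, x⟫ = 0 :=
  mem_hyperplane.1 (Submodule.mem_sInf.1 hx (hyperplane v)
    ⟨⟨v, hv.1, hv.2, rfl⟩, mem_hyperplane.2 hvq⟩)

variable {f : MvPolynomial (Fin n) ℝ} {α x : V n} {r : ℝ}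

theorem eq_zero_of_mem_flatThrough (hspan : Submodule.span ℝ {v | IsRoot G v} = ⊤)
    (hf : f ∈ invariants G) (hd : f.totalDegree ≤ 3) (hfin : (sphereExtrema f r).Finite)
    (hq : q ∈ sphereExtrema f r) (hα : IsRoot G α) (hαq : ⟪α, q⟫ ≠ 0)
    (hx : x ∈ flatThrough G q) (hαx : ⟪α, x⟫ = 0) : x = 0 := by
  by_contra hx0
  obtain ⟨β, hβ, hβx⟩ := exists_isRoot_inner_ne_zero hspan hx0
  have hβq : ⟪β, q⟫ ≠ 0 := fun h => hβx (inner_eq_zero_of_mem_flatThrough hβ h hx)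
  have hind : LinearIndependent ℝ ![α, β] := by
    refine LinearIndependent.pair_iff.2 fun s t hst => ?_
    have ht : t = 0 := by
      have h := congrArg (fun y => ⟪y, x⟫) hst
      simpa [inner_add_left, real_inner_smul_left, hαx, hβx] using h
    exact ⟨by simpa [ht, hα.1] using hst, ht⟩
  have hαβq : ⟪reflection β α, q⟫ ≠ 0 := fun h => by
    have hαβx := inner_eq_zero_of_mem_flatThrough (hα.map hβ.2) h hx
    rw [reflection_apply, inner_sub_left, real_inner_smul_left, hαx, zero_sub, neg_eq_zero] at hαβx
    rw [reflection_apply, (mul_eq_zero.1 hαβx).resolve_right hβx, zero_smul, sub_zero] at h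
    exact hαq h
  exact infinite_sphereExtrema_of_totalDegree_le_three hf hd hα hβ hind hαq hβq hαβq hq hfin

theorem sphereExtrema_subset_stratum_one (hspan : Submodule.span ℝ {v | IsRoot G v} = ⊤)
    (hf : f ∈ invariants G) (hd : f.totalDegree ≤ 3) (hn : 1 ≤ n)
    (hfin : (sphereExtrema f r).Finite) : sphereExtrema f r ⊆ stratum G 1 := by
  intro q hq
  rcases eq_or_ne q 0 with rfl | hq0
  · exact zero_mem_stratum hspan hn
  obtain ⟨α, hα, hαq⟩ := exists_isRoot_inner_ne_zero hspan hq0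
  have hbot : flatThrough G q ⊓ hyperplane α = ⊥ := (Submodule.eq_bot_iff _).2 fun x hx =>
    eq_zero_of_mem_flatThrough hspan hf hd hfin hq hα hαq hx.1 (mem_hyperplane.1 hx.2)
  refine ⟨flatThrough G q, isFlat_flatThrough G q, ?_, self_mem_flatThrough G q⟩
  rw [← finrank_inf_hyperplane (self_mem_flatThrough G q) hαq, hbot, finrank_bot]

end FirstStratum

section RealZeros

variable {f : MvPolynomial (Fin n) ℝ} {k : ℕ}

theorem smul_mem_stratum {x : V n} (hx : x ∈ stratum G k) (t : ℝ) : t • x ∈ stratum G k := by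
  obtain ⟨F, hF, hk, hxF⟩ := hx
  exact ⟨F, hF, hk, F.smul_mem t hxF⟩

theorem exists_zero_mem_stratum {a b : V n} (ha : a ∈ stratum G k) (hb : b ∈ stratum G k)
    (hfa : value f a ≤ 0) (hfb : 0 ≤ value f b) : (realVariety f ∩ stratum G k).Nonempty := by
  have hline (x : V n) : Continuous fun t : ℝ => value f (t • x) :=
    (differentiable_value f).continuous.comp (continuous_id.smul continuous_const)
  rcases le_total 0 (value f 0) with h0 | h0
  · obtain ⟨t, ht⟩ := mem_range_of_exists_le_of_exists_ge (hline a) (c := 0)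
      ⟨1, by rwa [one_smul]⟩ ⟨0, by rwa [zero_smul]⟩
    exact ⟨t • a, ht, smul_mem_stratum ha t⟩
  · obtain ⟨t, ht⟩ := mem_range_of_exists_le_of_exists_ge (hline b) (c := 0)
      ⟨0, by rwa [zero_smul]⟩ ⟨1, by rwa [one_smul]⟩
    exact ⟨t • b, ht, smul_mem_stratum hb t⟩

theorem nonempty_realVariety_iff (hfin : IsGFinite f)
    (h : ∀ r, (sphereExtrema f r).Finite → sphereExtrema f r ⊆ stratum G k) :
    (realVariety f).Nonempty ↔ (realVariety f ∩ stratum G k).Nonempty := by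
  refine ⟨fun hne => ?_, fun hne => hne.mono Set.inter_subset_left⟩
  obtain ⟨p, hp, hpfin⟩ := hfin.resolve_left hne.ne_empty
  have hpS : p ∈ Metric.sphere (0 : V n) ‖p‖ := mem_sphere_zero_iff_norm.2 rfl
  have hcont : ContinuousOn (value f) (Metric.sphere 0 ‖p‖) :=
    (differentiable_value f).continuous.continuousOn
  obtain ⟨a, ha, hmin⟩ := (isCompact_sphere (0 : V n) ‖p‖).exists_isMinOn ⟨p, hpS⟩ hcont
  obtain ⟨b, hb, hmax⟩ := (isCompact_sphere (0 : V n) ‖p‖).exists_isMaxOn ⟨p, hpS⟩ hcont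
  exact exists_zero_mem_stratum (h _ hpfin ⟨ha, Or.inl hmin⟩) (h _ hpfin ⟨hb, Or.inr hmax⟩)
    ((isMinOn_iff.1 hmin p hpS).trans_eq hp) (hp.symm.trans_le (isMaxOn_iff.1 hmax p hpS))

end RealZeros

end ReflectionVariety

theorem theorem4p3_general {n : ℕ} {G : Subgroup (V n ≃ₗᵢ[ℝ] V n)}
    (hspan : Submodule.span ℝ {v | IsRoot G v} = ⊤)
    {f : MvPolynomial (Fin n) ℝ} (hf : f ∈ invariants G) (hfin : IsGFinite f) :
    (∀ π : Fin n → MvPolynomial (Fin n) ℝ, IsBasicInvariants G π →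
      ∀ k : Fin n, f ∈ Algebra.adjoin ℝ (π '' Set.Iic k) →
        ((realVariety f).Nonempty ↔
          (realVariety f ∩ stratum G (secStrNum G π k)).Nonempty)) ∧
    (f.totalDegree ≠ 2 → f.totalDegree ≠ 3 →
      ((realVariety f).Nonempty ↔
        (realVariety f ∩ stratum G (strNum G f.totalDegree)).Nonempty)) ∧
    (f.totalDegree = 2 ∨ f.totalDegree = 3 →
      ((realVariety f).Nonempty ↔ (realVariety f ∩ stratum G 1).Nonempty)) := by
  refine ⟨fun π hπ k hfk => ?_, fun h2 h3 => ?_, fun h => ?_⟩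
  · refine nonempty_realVariety_iff hfin fun r =>
      sphereExtrema_subset_stratum_strNum_two_mul (hπ.two_le_totalDegree hspan k) ?_ hfk
    rintro _ ⟨j, hj, rfl⟩
    exact ⟨hπ.mem_invariants j, hπ.ordered hj⟩
  · rcases le_or_gt f.totalDegree 1 with h1 | h1
    · refine ⟨fun ⟨p, hp⟩ => ⟨0, ?_, zero_mem_stratum hspan (strNum_le G _)⟩,
        fun hne => hne.mono Set.inter_subset_left⟩
      exact (value_eq_of_totalDegree_le_one hspan hf h1 p).symm.trans hp
    · exact nonempty_realVariety_iff hfin fun r =>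
        sphereExtrema_subset_stratum_strNum hf (by omega)
  · have hn : 1 ≤ n := by
      by_contra! hn
      obtain rfl := Nat.lt_one_iff.1 hn
      have := (MvPolynomial.isHomogeneous_of_isEmpty (f := f)).totalDegree_le
      omega
    exact nonempty_realVariety_iff hfin fun r =>
      sphereExtrema_subset_stratum_one hspan hf (by omega) hn

theorem theorem4p3 (n : ℕ)
    (G : Subgroup (EuclideanSpace ℝ (Fin n) ≃ₗᵢ[ℝ] EuclideanSpace ℝ (Fin n)))
    (hG : IsReflectionGroup G) (hess : IsEssential G)
    (f : MvPolynomial (Fin n) ℝ) (hf : f ∈ invariants G) (hfin : IsGFinite f) :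
    (∀ π : Fin n → MvPolynomial (Fin n) ℝ, IsBasicInvariants G π →
      ∀ k : Fin n, f ∈ Algebra.adjoin ℝ (π '' Set.Iic k) →
        ((realVariety f).Nonempty ↔
          (realVariety f ∩ stratum G (secStrNum G π k)).Nonempty)) ∧
    (f.totalDegree ≠ 2 → f.totalDegree ≠ 3 →
      ((realVariety f).Nonempty ↔
        (realVariety f ∩ stratum G (strNum G f.totalDegree)).Nonempty)) ∧
    (f.totalDegree = 2 ∨ f.totalDegree = 3 →
      ((realVariety f).Nonempty ↔ (realVariety f ∩ stratum G 1).Nonempty)) :=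
  theorem4p3_general (span_roots_eq_top hG.generated hess) hf hfin
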